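/- Let $\tau\in\mathbb{C}$ with $\operatorname{Im}\tau>0$ and put $q=e^{\pi i\tau}$, so that $0<|q|<1$. Write $(a;q)_\infty=\prod_{i=0}^{\infty}(1-aq^i)$, $$\psi(q)=\frac{(q^2;q^2)_\infty}{(q;q^2)_\infty},\qquad \Pi_q=q^{1/4}\,\frac{(q^2;q^2)_\infty^2}{(q;q^2)_\infty^2}=q^{1/4}\psi^2(q),$$ where powers of $q$ are understood through $\tau$: $q^{1/4}=e^{\pi i\tau/4}$, and $\Pi_{q^3}$ is obtained from $\Pi_q$ by replacing $\tau$ with $3\tau$. Then $\Pi_q\neq 0$, the series below converges, and $$\sum_{n=1}^{\infty}\left(\frac{q^{2n}}{(1-q^{2n})^2}-\frac{q^{6n}}{(1-q^{6n})^2}-\frac{2q^{6n-3}}{(1-q^{6n-3})^2}\right)=\frac{\Pi_{q^3}^3}{\Pi_q}=q^2\,\frac{\psi^6(q^3)}{\psi^2(q)}.$$ -/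

import Mathlib

open Filter Topology

/-- The infinite `q`-shifted factorial `(a; q)_∞ = ∏_{i ≥ 0} (1 - a q ^ i)`, used for `‖q‖ < 1`. -/
noncomputable def qPochhammerInf (a q : ℂ) : ℂ := ∏' i : ℕ, (1 - a * q ^ i)

/-- For `‖q‖ < 1` the product converges: `(a; q)_∞` is the limit of the finite `q`-shifted
factorials `(a; q)_n`. -/
theorem tendsto_qPochhammerInf (a q : ℂ) (hq : ‖q‖ < 1) :
    Tendsto (fun n : ℕ => ∏ i ∈ Finset.range n, (1 - a * q ^ i)) atTop
      (𝓝 (qPochhammerInf a q)) := by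
  have hs : Summable fun i : ℕ => ‖-(a * q ^ i)‖ := by
    simpa [norm_mul, norm_pow] using
      (summable_geometric_of_lt_one (norm_nonneg q) hq).mul_left ‖a‖
  have hm : Multipliable fun i : ℕ => 1 - a * q ^ i := by
    simpa [sub_eq_add_neg] using multipliable_one_add_of_summable hs
  exact hm.hasProd.tendsto_prod_nat

/-- Ramanujan's theta function `ψ(q) = (q²; q²)_∞ / (q; q²)_∞`. -/
noncomputable def ramanujanPsi (q : ℂ) : ℂ :=
  qPochhammerInf (q ^ 2) (q ^ 2) / qPochhammerInf q (q ^ 2)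

/-- The variable `q = e ^ (π i τ)`. -/
noncomputable def nome (τ : ℂ) : ℂ := Complex.exp (Real.pi * Complex.I * τ)

/-- Gosper's constant `Π_q = q ^ (1/4) (q²; q²)_∞² / (q; q²)_∞²`, as a function of `τ`, where
`q = e ^ (π i τ)` and `q ^ (1/4)` means `e ^ (π i τ / 4)`.
Since `q ^ k = e ^ (π i (k τ))`, the constant `Π_{q ^ k}` is `gosperPi (k * τ)`. -/
noncomputable def gosperPi (τ : ℂ) : ℂ :=
  Complex.exp (Real.pi * Complex.I * τ / 4) *
    (qPochhammerInf (nome τ ^ 2) (nome τ ^ 2) ^ 2 / qPochhammerInf (nome τ) (nome τ ^ 2) ^ 2)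

/-! The identity is a special value of the factorization of `℘(u) - ℘(v)` into theta functions. In
multiplicative coordinates, `bilateralKoebeSum q` is `℘` up to an additive constant and scaling, and
`bilateralKoebeSum_sub` gives the factorization by a Liouville argument: the difference of the two
sides is invariant under `x ↦ x q`, its double pole at `1` cancels, so it is constant, and it
vanishes at `x = y`. Take base `q⁶`, `x = q²`, `y = q³`. The sum side involves exponents congruent
to `2`, `4` and `3` mod `6`; splitting `koebeSum (q²) (q²)` by residues mod `3` turns it into the
stated series. The theta side collapses to a quotient of `ψ` values after the same splitting of the
products. -/

theorem summable_norm_mul_pow (a : ℂ) {q : ℂ} (hq : ‖q‖ < 1) :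
    Summable fun i : ℕ => ‖-(a * q ^ i)‖ := by
  simpa [norm_mul, norm_pow] using
    (summable_geometric_of_lt_one (norm_nonneg q) hq).mul_left ‖a‖

theorem qPochhammerInf_eq_mul (a : ℂ) {q : ℂ} (hq : ‖q‖ < 1) :
    qPochhammerInf a q = (1 - a) * qPochhammerInf (a * q) q := by
  refine tendsto_nhds_unique ((tendsto_qPochhammerInf a q hq).comp (tendsto_add_atTop_nat 1)) ?_
  refine ((tendsto_qPochhammerInf (a * q) q hq).const_mul (1 - a)).congr fun n => ?_
  simp only [Function.comp, Finset.prod_range_succ']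
  rw [mul_comm]
  congr 1
  · exact Finset.prod_congr rfl fun i _ => by ring
  · simp

theorem qPochhammerInf_ne_zero {a q : ℂ} (hq : ‖q‖ < 1) (ha : ∀ i : ℕ, a * q ^ i ≠ 1) :
    qPochhammerInf a q ≠ 0 := by
  have := tprod_one_add_ne_zero_of_summable (f := fun i : ℕ => -(a * q ^ i))
    (fun i h => ha i (by linear_combination -h)) (summable_norm_mul_pow a hq)
  simpa only [← sub_eq_add_neg] using! this

theorem qPochhammerInf_ne_zero_of_norm_lt_one {a q : ℂ} (hq : ‖q‖ < 1) (ha : ‖a‖ < 1) :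
    qPochhammerInf a q ≠ 0 := by
  refine qPochhammerInf_ne_zero hq fun i h => ?_
  have h1 : ‖a * q ^ i‖ = 1 := by rw [h, norm_one]
  rw [norm_mul, norm_pow] at h1
  have : ‖q‖ ^ i ≤ 1 := pow_le_one₀ (norm_nonneg _) hq.le
  nlinarith [norm_nonneg a, norm_nonneg q]

theorem qPochhammerInf_one {q : ℂ} (hq : ‖q‖ < 1) : qPochhammerInf 1 q = 0 := by
  rw [qPochhammerInf_eq_mul 1 hq, sub_self, zero_mul]

theorem differentiable_qPochhammerInf {q : ℂ} (hq : ‖q‖ < 1) :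
    Differentiable ℂ fun a => qPochhammerInf a q := by
  intro a
  have hs : Summable fun i : ℕ => (‖a‖ + 1) * ‖q‖ ^ i :=
    (summable_geometric_of_lt_one (norm_nonneg q) hq).mul_left _
  have h := hs.hasProdLocallyUniformlyOn_nat_one_add (K := Metric.ball (0 : ℂ) (‖a‖ + 1))
    (f := fun i x => -(x * q ^ i)) Metric.isOpen_ball
    (.of_forall fun n x hx => by
      rw [norm_neg, norm_mul, norm_pow]
      gcongr
      exact (mem_ball_zero_iff.mp hx).le) (fun n => by fun_prop)
  have hd : DifferentiableOn ℂ (fun x => ∏' i : ℕ, (1 + -(x * q ^ i)))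
      (Metric.ball (0 : ℂ) (‖a‖ + 1)) := by
    refine TendstoLocallyUniformlyOn.differentiableOn
      (hasProdLocallyUniformlyOn_iff_tendstoLocallyUniformlyOn.mp h)
      (.of_forall fun s => ?_) Metric.isOpen_ball
    exact DifferentiableOn.fun_finsetProd fun i _ => by fun_prop
  have := hd.differentiableAt (Metric.isOpen_ball.mem_nhds
    (show a ∈ Metric.ball (0 : ℂ) (‖a‖ + 1) by simp))
  simpa only [← sub_eq_add_neg] using! this

theorem qPochhammerInf_trisect (a : ℂ) {q : ℂ} (hq : ‖q‖ < 1) :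
    qPochhammerInf a q = qPochhammerInf a (q ^ 3) * qPochhammerInf (a * q) (q ^ 3) *
      qPochhammerInf (a * q ^ 2) (q ^ 3) := by
  have hq3 : ‖q ^ 3‖ < 1 := by
    rw [norm_pow]; exact pow_lt_one₀ (norm_nonneg _) hq (by norm_num)
  have ht : Tendsto (fun n : ℕ => 3 * n) atTop atTop :=
    tendsto_id.const_mul_atTop' (by norm_num)
  refine tendsto_nhds_unique ((tendsto_qPochhammerInf a q hq).comp ht) ?_
  refine (((tendsto_qPochhammerInf a _ hq3).mul (tendsto_qPochhammerInf (a * q) _ hq3)).mul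
    (tendsto_qPochhammerInf (a * q ^ 2) _ hq3)).congr fun n => ?_
  simp only [Function.comp]
  induction n with
  | zero => simp
  | succ n ih =>
    rw [show 3 * (n + 1) = 3 * n + 1 + 1 + 1 by ring]
    simp only [Finset.prod_range_succ]
    rw [← ih]
    ring

/-! ### Lambert series of the Koebe function -/

/-- The Koebe function `x / (1 - x)²`. -/
noncomputable def koebe (x : ℂ) : ℂ := x / (1 - x) ^ 2

theorem koebe_inv (x : ℂ) : koebe x⁻¹ = koebe x := by
  rcases eq_or_ne x 0 with rfl | hx
  · simp
  rcases eq_or_ne x 1 with rfl | h1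
  · simp
  have h2 : 1 - x ≠ 0 := sub_ne_zero.mpr h1.symm
  have h3 : 1 - x⁻¹ = -(1 - x) / x := by field_simp; ring
  rw [koebe, koebe, h3]
  field_simp

theorem norm_koebe_le {x : ℂ} {r : ℝ} (hr : r < 1) (hx : ‖x‖ ≤ r) :
    ‖koebe x‖ ≤ ‖x‖ / (1 - r) ^ 2 := by
  have h : 1 - r ≤ ‖1 - x‖ := by
    have := norm_sub_norm_le (1 : ℂ) x
    rw [norm_one] at this
    linarith
  have h0 : 0 < 1 - r := by linarith
  rw [koebe, norm_div, norm_pow]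
  gcongr

/-- The Lambert series `∑_{n ≥ 0} x qⁿ / (1 - x qⁿ)²`. -/
noncomputable def koebeSum (q x : ℂ) : ℂ := ∑' n : ℕ, koebe (x * q ^ n)

theorem norm_koebe_mul_pow_le {q x : ℂ} {r : ℝ} (hq : ‖q‖ < 1) (hr : r < 1) (hx : ‖x‖ ≤ r)
    (n : ℕ) : ‖koebe (x * q ^ n)‖ ≤ r / (1 - r) ^ 2 * ‖q‖ ^ n := by
  have h1 : ‖x * q ^ n‖ ≤ r * ‖q‖ ^ n := by
    rw [norm_mul, norm_pow]; gcongr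
  have h2 : r * ‖q‖ ^ n ≤ r :=
    mul_le_of_le_one_right ((norm_nonneg x).trans hx) (pow_le_one₀ (norm_nonneg _) hq.le)
  calc _ ≤ ‖x * q ^ n‖ / (1 - r) ^ 2 := norm_koebe_le hr (h1.trans h2)
    _ ≤ r * ‖q‖ ^ n / (1 - r) ^ 2 := by gcongr
    _ = _ := by ring

theorem hasSum_koebeSum {q x : ℂ} (hq : ‖q‖ < 1) (hx : ‖x‖ < 1) :
    HasSum (fun n : ℕ => koebe (x * q ^ n)) (koebeSum q x) :=
  (Summable.of_norm_bounded ((summable_geometric_of_lt_one (norm_nonneg q) hq).mul_left _)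
    (norm_koebe_mul_pow_le hq hx le_rfl)).hasSum

theorem koebeSum_eq_add {q x : ℂ} (hq : ‖q‖ < 1) (hx : ‖x‖ < 1) :
    koebeSum q x = koebe x + koebeSum q (x * q) := by
  rw [koebeSum, (hasSum_koebeSum hq hx).summable.tsum_eq_zero_add, koebeSum]
  simp [pow_succ', mul_assoc]

theorem differentiableAt_koebeSum {q x : ℂ} (hq : ‖q‖ < 1) (hx : ‖x‖ < 1) :
    DifferentiableAt ℂ (koebeSum q) x := by
  obtain ⟨r, hxr, hr⟩ := exists_between hx
  have hd : DifferentiableOn ℂ (fun x => ∑' n : ℕ, koebe (x * q ^ n)) (Metric.ball 0 r) := by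
    refine Complex.differentiableOn_tsum_of_summable_norm
      ((summable_geometric_of_lt_one (norm_nonneg q) hq).mul_left _) (fun n w hw => ?_)
      Metric.isOpen_ball
      fun n w hw => norm_koebe_mul_pow_le hq hr (mem_ball_zero_iff.mp hw).le n
    have hne : (1 - w * q ^ n) ^ 2 ≠ 0 := by
      refine pow_ne_zero _ (sub_ne_zero.mpr fun h => ?_)
      have h1 : ‖w * q ^ n‖ = 1 := by rw [← h, norm_one]
      rw [norm_mul, norm_pow] at h1
      have : ‖q‖ ^ n ≤ 1 := pow_le_one₀ (norm_nonneg _) hq.le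
      nlinarith [norm_nonneg w, norm_nonneg q, mem_ball_zero_iff.mp hw]
    have d : DifferentiableAt ℂ (fun w => w * q ^ n) w := by fun_prop
    exact (d.div (c := fun w => w * q ^ n) (d := fun w => (1 - w * q ^ n) ^ 2)
      (by fun_prop) hne).differentiableWithinAt
  exact hd.differentiableAt (Metric.isOpen_ball.mem_nhds (mem_ball_zero_iff.mpr hxr))

/-! ### Theta product and a Liouville theorem on the annulus -/

/-- The Jacobi theta product `(x; q)_∞ (q / x; q)_∞`. -/
noncomputable def qTheta (q x : ℂ) : ℂ := qPochhammerInf x q * qPochhammerInf (q / x) q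

theorem qTheta_mul {q x : ℂ} (hq : ‖q‖ < 1) (hq0 : q ≠ 0) (hx : x ≠ 0) :
    qTheta q (x * q) = -x⁻¹ * qTheta q x := by
  have h1 := qPochhammerInf_eq_mul x hq
  have h2 := qPochhammerInf_eq_mul x⁻¹ hq
  rw [qTheta, qTheta, show q / (x * q) = x⁻¹ by field_simp, h2, h1,
    show x⁻¹ * q = q / x by field_simp]
  field_simp
  ring

theorem qTheta_one {q : ℂ} (hq : ‖q‖ < 1) : qTheta q 1 = 0 := by
  rw [qTheta, qPochhammerInf_one hq, zero_mul]

theorem differentiableAt_qTheta {q x : ℂ} (hq : ‖q‖ < 1) (hx : x ≠ 0) :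
    DifferentiableAt ℂ (qTheta q) x := by
  have h := differentiable_qPochhammerInf hq
  exact (h x).mul ((h (q / x)).comp x (by fun_prop (disch := assumption)))

/-- The annulus `‖q‖ < ‖x‖ < ‖q‖⁻¹`. -/
def qAnnulus (q : ℂ) : Set ℂ := {x | ‖q‖ < ‖x‖ ∧ ‖x‖ * ‖q‖ < 1}

theorem ne_zero_of_mem_qAnnulus {q x : ℂ} (hx : x ∈ qAnnulus q) : x ≠ 0 :=
  norm_pos_iff.mp ((norm_nonneg q).trans_lt hx.1)

theorem norm_mul_lt_one_of_mem_qAnnulus {q x : ℂ} (hx : x ∈ qAnnulus q) : ‖x * q‖ < 1 := by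
  rw [norm_mul]; exact hx.2

theorem norm_div_lt_one_of_mem_qAnnulus {q x : ℂ} (hx : x ∈ qAnnulus q) : ‖q / x‖ < 1 := by
  rw [norm_div]; exact (div_lt_one ((norm_nonneg q).trans_lt hx.1)).mpr hx.1

theorem isOpen_qAnnulus (q : ℂ) : IsOpen (qAnnulus q) :=
  (isOpen_lt continuous_const continuous_norm).inter
    (isOpen_lt (continuous_norm.mul continuous_const) continuous_const)

theorem isPreconnected_qAnnulus {q : ℂ} (hq0 : q ≠ 0) : IsPreconnected (qAnnulus q) := by
  have hpos : 0 < ‖q‖ := norm_pos_iff.mpr hq0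
  -- The annulus is the image under `exp` of a vertical strip, which is convex.
  have h : qAnnulus q =
      Complex.exp '' (Complex.reLm ⁻¹' Set.Ioo (Real.log ‖q‖) (-Real.log ‖q‖)) := by
    ext x
    constructor
    · intro hx
      have hx0 : x ≠ 0 := ne_zero_of_mem_qAnnulus hx
      have hxp : 0 < ‖x‖ := norm_pos_iff.mpr hx0
      refine ⟨Complex.log x, ⟨?_, ?_⟩, Complex.exp_log hx0⟩
      · simpa [Complex.log_re] using Real.log_lt_log hpos hx.1
      · have := Real.log_lt_log (by positivity) hx.2
        rw [Real.log_mul hxp.ne' hpos.ne', Real.log_one] at this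
        simp only [Complex.reLm_coe, Complex.log_re]
        linarith
    · rintro ⟨z, ⟨h1, h2⟩, rfl⟩
      simp only [Complex.reLm_coe] at h1 h2
      refine ⟨?_, ?_⟩
      · rw [Complex.norm_exp]
        exact (Real.log_lt_iff_lt_exp hpos).mp h1
      · calc ‖Complex.exp z‖ * ‖q‖ = Real.exp (z.re + Real.log ‖q‖) := by
              rw [Complex.norm_exp, Real.exp_add, Real.exp_log hpos]
          _ < 1 := Real.exp_lt_one_iff.mpr (by linarith)
  rw [h]
  exact (((convex_Ioo _ _).linear_preimage Complex.reLm).isPreconnected).image _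
    Complex.continuous_exp.continuousOn

/-- A holomorphic function on the annulus `‖q‖ < ‖x‖ < ‖q‖⁻¹` that is invariant under `x ↦ x q`
is constant. -/
theorem eq_of_mul_invariant_on_qAnnulus {q : ℂ} (hq : ‖q‖ < 1) (hq0 : q ≠ 0) {f : ℂ → ℂ}
    (hf : DifferentiableOn ℂ f (qAnnulus q))
    (hinv : ∀ x ∈ qAnnulus q, 1 < ‖x‖ → f (x * q) = f x) {x y : ℂ}
    (hx : x ∈ qAnnulus q) (hy : y ∈ qAnnulus q) : f x = f y := by
  have hpos : 0 < ‖q‖ := norm_pos_iff.mpr hq0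
  -- A compact fundamental domain `‖q‖^(1/2) ≤ ‖x‖ ≤ ‖q‖^(-1/2)`: by invariance the maximum of `‖f‖`
  -- on `K` is a maximum on the whole open annulus, so the maximum principle applies.
  set K : Set ℂ := {x | ‖q‖ ≤ ‖x‖ ^ 2 ∧ ‖x‖ ^ 2 * ‖q‖ ≤ 1} with hK
  have hKU : K ⊆ qAnnulus q := by
    rintro z ⟨h1, h2⟩
    refine ⟨lt_of_pow_lt_pow_left₀ 2 (norm_nonneg _) ?_,
      (pow_lt_one_iff_of_nonneg (by positivity) two_ne_zero).mp ?_⟩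
    · nlinarith
    · nlinarith
  have hKc : IsCompact K := by
    refine Metric.isCompact_of_isClosed_isBounded
      ((isClosed_le continuous_const (continuous_norm.pow 2)).inter
        (isClosed_le ((continuous_norm.pow 2).mul continuous_const) continuous_const)) ?_
    refine isBounded_iff_forall_norm_le.mpr ⟨1 / ‖q‖, fun z hz => ?_⟩
    rw [le_div_iff₀ hpos]
    exact (hKU hz).2.le
  have h1K : (1 : ℂ) ∈ K := by simp [hK, hq.le]
  obtain ⟨c, hcK, hc⟩ := hKc.exists_isMaxOn ⟨1, h1K⟩
    ((hf.continuousOn.mono hKU).norm)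
  have hrep : ∀ z ∈ qAnnulus q, ∃ w ∈ K, f z = f w := by
    intro z hz
    have hz0 : 0 < ‖z‖ := norm_pos_iff.mpr (ne_zero_of_mem_qAnnulus hz)
    by_cases h1 : ‖z‖ ^ 2 < ‖q‖
    · have hw : z / q ∈ K := by
        have : 1 < ‖z‖ / ‖q‖ := (one_lt_div hpos).mpr hz.1
        refine ⟨?_, ?_⟩
        · rw [norm_div]; nlinarith
        · rw [norm_div, div_pow, div_mul_eq_mul_div, div_le_one (by positivity)]
          nlinarith
      refine ⟨z / q, hw, ?_⟩
      rw [← hinv (z / q) (hKU hw) (by rw [norm_div]; exact (one_lt_div hpos).mpr hz.1),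
        div_mul_cancel₀ z hq0]
    by_cases h2 : 1 < ‖z‖ ^ 2 * ‖q‖
    · refine ⟨z * q, ⟨?_, ?_⟩, (hinv z hz ?_).symm⟩
      · rw [norm_mul]; nlinarith
      · have h3 : ‖z * q‖ ^ 2 ≤ 1 :=
          pow_le_one₀ (norm_nonneg _) (norm_mul_lt_one_of_mem_qAnnulus hz).le
        nlinarith
      · by_contra! h
        nlinarith [hz.2]
    · exact ⟨z, ⟨not_lt.mp h1, not_lt.mp h2⟩, rfl⟩
  have hmax : IsMaxOn (norm ∘ f) (qAnnulus q) c := by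
    intro z hz
    obtain ⟨w, hw, hzw⟩ := hrep z hz
    simpa [hzw] using hc hw
  have hcon := Complex.eqOn_of_isPreconnected_of_isMaxOn_norm (isPreconnected_qAnnulus hq0)
    (isOpen_qAnnulus q) hf (hKU hcK) hmax
  exact (hcon hx).trans (hcon hy).symm

/-! ### Factorization of a difference of two `℘` values -/

/-- The Lambert series `∑_{n ∈ ℤ} x qⁿ / (1 - x qⁿ)²`, with the terms of index `n` and `-n`
folded together. -/
noncomputable def bilateralKoebeSum (q x : ℂ) : ℂ :=
  koebe x + (koebeSum q (x * q) + koebeSum q (q / x))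

/-- The shift reindexes the bilateral sum: one term passes from one tail to the other through
`koebe_inv`. -/
theorem bilateralKoebeSum_mul {q x : ℂ} (hq : ‖q‖ < 1) (hq0 : q ≠ 0) (hx : x ∈ qAnnulus q)
    (h1 : 1 < ‖x‖) : bilateralKoebeSum q (x * q) = bilateralKoebeSum q x := by
  have hx0 := ne_zero_of_mem_qAnnulus hx
  have h2 : ‖x⁻¹‖ < 1 := by rw [norm_inv]; exact inv_lt_one_of_one_lt₀ h1
  have e1 := koebeSum_eq_add hq (norm_mul_lt_one_of_mem_qAnnulus hx)
  have e2 := koebeSum_eq_add hq h2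
  rw [koebe_inv, show x⁻¹ * q = q / x by field_simp] at e2
  rw [bilateralKoebeSum, bilateralKoebeSum, show q / (x * q) = x⁻¹ by field_simp, e2, e1]
  ring

/-- The theta quotient that equals the difference of two values of `bilateralKoebeSum`. -/
noncomputable def thetaQuotient (q y x : ℂ) : ℂ :=
  x * qTheta q (x * y) * qTheta q (y / x) * qPochhammerInf q q ^ 4 /
    (qTheta q x ^ 2 * qTheta q y ^ 2)

/-- The theta multipliers contribute `1 / q` in total, which the prefactor `x` compensates. -/
theorem thetaQuotient_mul {q x y : ℂ} (hq : ‖q‖ < 1) (hq0 : q ≠ 0) (hx : x ≠ 0) (hy : y ≠ 0) :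
    thetaQuotient q y (x * q) = thetaQuotient q y x := by
  have e1 : qTheta q (x * q * y) = -(x * y)⁻¹ * qTheta q (x * y) := by
    rw [← qTheta_mul hq hq0 (mul_ne_zero hx hy)]
    congr 1; ring
  have e2 : qTheta q (y / x) = -(y / (x * q))⁻¹ * qTheta q (y / (x * q)) := by
    rw [← qTheta_mul hq hq0 (by positivity)]
    congr 1; field_simp
  rw [thetaQuotient, thetaQuotient, e1, e2, qTheta_mul hq hq0 hx]
  by_cases hx' : qTheta q x = 0
  · simp [hx']
  by_cases hy' : qTheta q y = 0
  · simp [hy']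
  field_simp

/-- `thetaQuotient` divided by `koebe x`, without its singularity at `x = 1`. -/
noncomputable def thetaQuotientRegular (q y x : ℂ) : ℂ :=
  qTheta q (x * y) * qTheta q (y / x) * qPochhammerInf q q ^ 4 /
    ((qPochhammerInf (x * q) q * qPochhammerInf (q / x) q) ^ 2 * qTheta q y ^ 2)

theorem thetaQuotient_eq_koebe_mul {q : ℂ} (hq : ‖q‖ < 1) (y x : ℂ) :
    thetaQuotient q y x = koebe x * thetaQuotientRegular q y x := by
  have h : qTheta q x = (1 - x) * (qPochhammerInf (x * q) q * qPochhammerInf (q / x) q) := by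
    rw [qTheta, qPochhammerInf_eq_mul x hq, mul_assoc]
  rw [thetaQuotient, thetaQuotientRegular, koebe, h, div_mul_div_comm]
  congr 1 <;> ring

theorem thetaQuotientRegular_inv (q y x : ℂ) :
    thetaQuotientRegular q y x⁻¹ = thetaQuotientRegular q y x := by
  rw [thetaQuotientRegular, thetaQuotientRegular, div_inv_eq_mul, div_inv_eq_mul,
    inv_mul_eq_div, inv_mul_eq_div, mul_comm y x, mul_comm q x,
    mul_comm (qTheta q (y / x)), mul_comm (qPochhammerInf (q / x) q)]

theorem thetaQuotientRegular_one {q y : ℂ} (hq : ‖q‖ < 1) (hy : qTheta q y ≠ 0) :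
    thetaQuotientRegular q y 1 = 1 := by
  have := qPochhammerInf_ne_zero_of_norm_lt_one hq hq
  simp only [thetaQuotientRegular, one_mul, div_one]
  field_simp

theorem differentiableOn_thetaQuotientRegular {q y : ℂ} (hq : ‖q‖ < 1) (hy : y ≠ 0)
    (hθ : qTheta q y ≠ 0) :
    DifferentiableOn ℂ (thetaQuotientRegular q y) (qAnnulus q) := by
  intro x hx
  have hx0 := ne_zero_of_mem_qAnnulus hx
  have h := differentiable_qPochhammerInf hq
  have d1 : DifferentiableAt ℂ (fun x => qTheta q (x * y)) x :=
    (differentiableAt_qTheta hq (mul_ne_zero hx0 hy)).comp (f := fun x => x * y) x (by fun_prop)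
  have d2 : DifferentiableAt ℂ (fun x => qTheta q (y / x)) x :=
    (differentiableAt_qTheta hq (div_ne_zero hy hx0)).comp (f := fun x => y / x) x
      (by fun_prop (disch := assumption))
  have d3 : DifferentiableAt ℂ (fun x => qPochhammerInf (x * q) q) x :=
    (h (x * q)).comp (f := fun x => x * q) x (by fun_prop)
  have d4 : DifferentiableAt ℂ (fun x => qPochhammerInf (q / x) q) x :=
    (h (q / x)).comp (f := fun x => q / x) x (by fun_prop (disch := assumption))
  have n1 := qPochhammerInf_ne_zero_of_norm_lt_one hq (norm_mul_lt_one_of_mem_qAnnulus hx)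
  have n2 := qPochhammerInf_ne_zero_of_norm_lt_one hq (norm_div_lt_one_of_mem_qAnnulus hx)
  exact (((d1.mul d2).mul_const _).div (((d3.mul d4).pow 2).mul_const _)
    (mul_ne_zero (pow_ne_zero _ (mul_ne_zero n1 n2)) (pow_ne_zero _ hθ))).differentiableWithinAt

/-- A function that is differentiable on a neighbourhood `s` of `1`, takes the value `1` there and
is invariant under `x ↦ x⁻¹`, equals `1` up to a double zero. -/
theorem exists_one_sub_eq_sq_mul {f : ℂ → ℂ} {s : Set ℂ} (hs : s ∈ 𝓝 (1 : ℂ))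
    (hf : DifferentiableOn ℂ f s) (h1 : f 1 = 1) (hinv : ∀ x, f x⁻¹ = f x) :
    ∃ k : ℂ → ℂ, DifferentiableOn ℂ k s ∧ ∀ x, 1 - f x = (1 - x) ^ 2 * k x := by
  -- Inversion has derivative `-1` at `1`, so `f' 1 = -f' 1`.
  have hd : deriv f 1 = 0 := by
    have h := (hf.differentiableAt hs).hasDerivAt
    have h2 : HasDerivAt (fun x => f x⁻¹) (deriv f 1 * (-((1 : ℂ) ^ 2)⁻¹)) 1 := by
      refine HasDerivAt.comp (h₂ := f) (1 : ℂ) ?_ (hasDerivAt_inv one_ne_zero)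
      simpa using h
    simp only [hinv] at h2
    have h3 := h.unique h2
    simp only [one_pow, inv_one, mul_neg, mul_one] at h3
    linear_combination h3 / 2
  set u : ℂ → ℂ := fun x => 1 - f x with hu
  have hu1 : u 1 = 0 := by simp [hu, h1]
  have hdu : dslope u 1 1 = 0 := by
    rw [dslope_same, hu, deriv_const_sub, hd, neg_zero]
  refine ⟨dslope (dslope u 1) 1, (Complex.differentiableOn_dslope hs).mpr
    ((Complex.differentiableOn_dslope hs).mpr (hf.const_sub 1)), fun x => ?_⟩
  have e1 := sub_smul_dslope u 1 x
  have e2 := sub_smul_dslope (dslope u 1) 1 x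
  rw [hu1, sub_zero, smul_eq_mul] at e1
  rw [hdu, sub_zero, smul_eq_mul] at e2
  change u x = _
  rw [← e1, ← e2]
  ring

theorem qTheta_ne_zero_of_mem_qAnnulus {q x : ℂ} (hq : ‖q‖ < 1) (hx : x ∈ qAnnulus q)
    (h1 : x ≠ 1) : qTheta q x ≠ 0 := by
  rw [qTheta, qPochhammerInf_eq_mul x hq]
  exact mul_ne_zero (mul_ne_zero (sub_ne_zero.mpr h1.symm)
    (qPochhammerInf_ne_zero_of_norm_lt_one hq (norm_mul_lt_one_of_mem_qAnnulus hx)))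
    (qPochhammerInf_ne_zero_of_norm_lt_one hq (norm_div_lt_one_of_mem_qAnnulus hx))

/-- The factorization of `℘(u) - ℘(v)` as a theta quotient, in multiplicative coordinates. -/
theorem bilateralKoebeSum_sub {q x y : ℂ} (hq : ‖q‖ < 1) (hq0 : q ≠ 0) (hx : x ∈ qAnnulus q)
    (hy : y ∈ qAnnulus q) (hx1 : x ≠ 1) (hy1 : y ≠ 1) :
    bilateralKoebeSum q x - bilateralKoebeSum q y = thetaQuotient q y x := by
  have hy0 := ne_zero_of_mem_qAnnulus hy
  have hθ := qTheta_ne_zero_of_mem_qAnnulus hq hy hy1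
  have hone : (1 : ℂ) ∈ qAnnulus q := by simp [qAnnulus, hq]
  have hdR := differentiableOn_thetaQuotientRegular hq hy0 hθ
  obtain ⟨k, hk, hkeq⟩ := exists_one_sub_eq_sq_mul ((isOpen_qAnnulus q).mem_nhds hone) hdR
    (thetaQuotientRegular_one hq hθ) (thetaQuotientRegular_inv q y)
  -- The difference of the two sides with its singularity at `1` removed: `z * k z` extends `koebe z
  -- * (1 - thetaQuotientRegular q y z)`.
  set f : ℂ → ℂ := fun z => z * k z + (koebeSum q (z * q) + koebeSum q (q / z)) with hf
  have hfeq : ∀ z, z ≠ 1 → f z = bilateralKoebeSum q z - thetaQuotient q y z := by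
    intro z hz
    have h1z : 1 - z ≠ 0 := sub_ne_zero.mpr hz.symm
    have : z * k z = koebe z - koebe z * thetaQuotientRegular q y z := by
      have : koebe z * (1 - thetaQuotientRegular q y z) = z * k z := by
        rw [hkeq, koebe]; field_simp
      linear_combination -this
    rw [thetaQuotient_eq_koebe_mul hq, bilateralKoebeSum, hf]
    linear_combination this
  have hfd : DifferentiableOn ℂ f (qAnnulus q) := by
    refine (differentiableOn_id.mul hk).add fun z hz => ?_
    have hz0 := ne_zero_of_mem_qAnnulus hz
    refine (DifferentiableAt.add ?_ ?_).differentiableWithinAt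
    · exact (differentiableAt_koebeSum hq (norm_mul_lt_one_of_mem_qAnnulus hz)).comp
        (f := fun z => z * q) z (by fun_prop)
    · exact (differentiableAt_koebeSum hq (norm_div_lt_one_of_mem_qAnnulus hz)).comp
        (f := fun z => q / z) z (by fun_prop (disch := assumption))
  have hinv : ∀ z ∈ qAnnulus q, 1 < ‖z‖ → f (z * q) = f z := by
    intro z hz h1
    rw [hfeq z, hfeq (z * q), bilateralKoebeSum_mul hq hq0 hz h1,
      thetaQuotient_mul hq hq0 (ne_zero_of_mem_qAnnulus hz) hy0]
    · intro h
      have := norm_mul_lt_one_of_mem_qAnnulus hz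
      rw [h, norm_one] at this
      exact this.false
    · rintro rfl
      simp at h1
  have h := eq_of_mul_invariant_on_qAnnulus hq hq0 hfd hinv hx hy
  rw [hfeq x hx1, hfeq y hy1] at h
  -- The constant is read off at `x = y`, where the factor `qTheta q (y / x)` vanishes.
  have hF : thetaQuotient q y y = 0 := by
    rw [thetaQuotient, div_self hy0, qTheta_one hq]
    simp
  rw [hF] at h
  linear_combination h

/-! ### Trisection and specialization to base `q⁶` -/

theorem koebeSum_trisect {q x : ℂ} (hq : ‖q‖ < 1) (hx : ‖x‖ < 1) :
    koebeSum q x = koebeSum (q ^ 3) x + koebeSum (q ^ 3) (x * q) + koebeSum (q ^ 3) (x * q ^ 2) := by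
  have hq3 : ‖q ^ 3‖ < 1 := by
    rw [norm_pow]; exact pow_lt_one₀ (norm_nonneg _) hq (by norm_num)
  have hxq : ∀ n : ℕ, ‖x * q ^ n‖ < 1 := fun n => by
    rw [norm_mul, norm_pow]
    exact mul_lt_one_of_nonneg_of_lt_one_left (norm_nonneg _) hx
      (pow_le_one₀ (norm_nonneg _) hq.le)
  have ht : Tendsto (fun n : ℕ => 3 * n) atTop atTop :=
    tendsto_id.const_mul_atTop' (by norm_num)
  have h1 := (hasSum_koebeSum hq3 (by simpa using hxq 1 : ‖x * q‖ < 1)).tendsto_sum_nat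
  refine tendsto_nhds_unique ((hasSum_koebeSum hq hx).tendsto_sum_nat.comp ht) ?_
  refine (((hasSum_koebeSum hq3 hx).tendsto_sum_nat.add h1).add
    (hasSum_koebeSum hq3 (hxq 2)).tendsto_sum_nat).congr fun n => ?_
  simp only [Function.comp]
  induction n with
  | zero => simp
  | succ n ih =>
    rw [show 3 * (n + 1) = 3 * n + 1 + 1 + 1 by ring]
    simp only [Finset.sum_range_succ]
    rw [← ih, show x * q * (q ^ 3) ^ n = x * q ^ (3 * n + 1) by ring,
      show x * q ^ 2 * (q ^ 3) ^ n = x * q ^ (3 * n + 1 + 1) by ring, ← pow_mul]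
    ring

theorem bilateralKoebeSum_eq {q x : ℂ} (hq : ‖q‖ < 1) (hx : ‖x‖ < 1) :
    bilateralKoebeSum q x = koebeSum q x + koebeSum q (q / x) := by
  rw [bilateralKoebeSum, koebeSum_eq_add hq hx, add_assoc]

theorem norm_nome_lt_one {τ : ℂ} (hτ : 0 < τ.im) : ‖nome τ‖ < 1 := by
  rw [nome, Complex.norm_exp, Real.exp_lt_one_iff]
  simpa using mul_pos Real.pi_pos hτ

theorem ramanujanPsi_ne_zero {q : ℂ} (hq : ‖q‖ < 1) : ramanujanPsi q ≠ 0 := by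
  have hq2 : ‖q ^ 2‖ < 1 := by
    rw [norm_pow]; exact pow_lt_one₀ (norm_nonneg _) hq two_ne_zero
  exact div_ne_zero (qPochhammerInf_ne_zero_of_norm_lt_one hq2 hq2)
    (qPochhammerInf_ne_zero_of_norm_lt_one hq2 hq)

theorem gosperPi_eq (τ : ℂ) :
    gosperPi τ = Complex.exp (Real.pi * Complex.I * τ / 4) * ramanujanPsi (nome τ) ^ 2 := by
  rw [gosperPi, ramanujanPsi, div_pow]

theorem nome_three_mul (τ : ℂ) : nome (3 * τ) = nome τ ^ 3 := by
  rw [nome, nome, ← Complex.exp_nat_mul]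
  congr 1; push_cast; ring

theorem gosperPi_ne_zero {τ : ℂ} (hτ : 0 < τ.im) : gosperPi τ ≠ 0 := by
  rw [gosperPi_eq]
  exact mul_ne_zero (Complex.exp_ne_zero _)
    (pow_ne_zero _ (ramanujanPsi_ne_zero (norm_nome_lt_one hτ)))

theorem gosperPi_cube_div (τ : ℂ) : gosperPi (3 * τ) ^ 3 / gosperPi τ =
    nome τ ^ 2 * ramanujanPsi (nome τ ^ 3) ^ 6 / ramanujanPsi (nome τ) ^ 2 := by
  -- Exponents of `q`: `3 * (3/4) = 1/4 + 2`.
  have h : Complex.exp (Real.pi * Complex.I * (3 * τ) / 4) ^ 3 =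
      Complex.exp (Real.pi * Complex.I * τ / 4) * nome τ ^ 2 := by
    rw [nome, ← Complex.exp_nat_mul, ← Complex.exp_nat_mul, ← Complex.exp_add]
    congr 1; push_cast; ring
  rw [gosperPi_eq, gosperPi_eq, nome_three_mul, mul_pow, h, mul_assoc,
    mul_div_mul_left _ _ (Complex.exp_ne_zero _), ← pow_mul]

/-- The theta quotient at `x = q²`, `y = q³` to the base `q⁶`, in terms of `ψ`. -/
theorem thetaQuotient_eq_ramanujanPsi {q : ℂ} (hq : ‖q‖ < 1) (hq0 : q ≠ 0) :
    thetaQuotient (q ^ 6) (q ^ 3) (q ^ 2) =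
      q ^ 2 * ramanujanPsi (q ^ 3) ^ 6 / ramanujanPsi q ^ 2 := by
  have hpow : ∀ n : ℕ, n ≠ 0 → ‖q ^ n‖ < 1 := fun n hn => by
    rw [norm_pow]; exact pow_lt_one₀ (norm_nonneg _) hq hn
  have hA : ∀ n : ℕ, n ≠ 0 → qPochhammerInf (q ^ n) (q ^ 6) ≠ 0 := fun n hn =>
    qPochhammerInf_ne_zero_of_norm_lt_one (hpow 6 (by norm_num)) (hpow n hn)
  have h1 : qPochhammerInf q (q ^ 6) ≠ 0 := by simpa using hA 1 one_ne_zero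
  have h2 := hA 2 (by norm_num)
  have h3 := hA 3 (by norm_num)
  have h4 := hA 4 (by norm_num)
  have h5 := hA 5 (by norm_num)
  have h6 := hA 6 (by norm_num)
  have e1 : ramanujanPsi q = qPochhammerInf (q ^ 2) (q ^ 6) * qPochhammerInf (q ^ 4) (q ^ 6) *
      qPochhammerInf (q ^ 6) (q ^ 6) / (qPochhammerInf q (q ^ 6) *
      qPochhammerInf (q ^ 3) (q ^ 6) * qPochhammerInf (q ^ 5) (q ^ 6)) := by
    rw [ramanujanPsi, qPochhammerInf_trisect (q ^ 2) (hpow 2 two_ne_zero),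
      qPochhammerInf_trisect q (hpow 2 two_ne_zero)]
    ring_nf
  have e3 : ramanujanPsi (q ^ 3) =
      qPochhammerInf (q ^ 6) (q ^ 6) / qPochhammerInf (q ^ 3) (q ^ 6) := by
    rw [ramanujanPsi, ← pow_mul]
  rw [e1, e3]
  simp only [thetaQuotient, qTheta]
  rw [show q ^ 2 * q ^ 3 = q ^ 5 by ring, show q ^ 3 / q ^ 2 = q by field_simp,
    show q ^ 6 / q ^ 5 = q by field_simp, show q ^ 6 / q = q ^ 5 by field_simp,
    show q ^ 6 / q ^ 2 = q ^ 4 by field_simp, show q ^ 6 / q ^ 3 = q ^ 3 by field_simp]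
  field_simp

theorem hasSum_koebe_eq_ramanujanPsi {q : ℂ} (hq : ‖q‖ < 1) (hq0 : q ≠ 0) :
    HasSum (fun n : ℕ => koebe (q ^ (2 * (n + 1))) - koebe (q ^ (6 * (n + 1)))
        - 2 * koebe (q ^ (6 * (n + 1) - 3)))
      (q ^ 2 * ramanujanPsi (q ^ 3) ^ 6 / ramanujanPsi q ^ 2) := by
  have hpow : ∀ n : ℕ, n ≠ 0 → ‖q ^ n‖ < 1 := fun n hn => by
    rw [norm_pow]; exact pow_lt_one₀ (norm_nonneg _) hq hn
  have hne : ∀ n : ℕ, n ≠ 0 → q ^ n ≠ 1 := fun n hn h => by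
    have := hpow n hn
    rw [h, norm_one] at this
    exact this.false
  have hmem : ∀ n : ℕ, n ≠ 0 → n < 6 → q ^ n ∈ qAnnulus (q ^ 6) := fun n hn h6 => by
    refine ⟨?_, ?_⟩
    · rw [norm_pow, norm_pow]
      exact pow_lt_pow_right_of_lt_one₀ (norm_pos_iff.mpr hq0) hq h6
    · rw [← norm_mul, ← pow_add]
      exact hpow _ (by omega)
  have hsub := bilateralKoebeSum_sub (hpow 6 (by norm_num)) (pow_ne_zero 6 hq0)
    (hmem 2 (by norm_num) (by norm_num)) (hmem 3 (by norm_num) (by norm_num))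
    (hne 2 (by norm_num)) (hne 3 (by norm_num))
  rw [bilateralKoebeSum_eq (hpow 6 (by norm_num)) (hpow 2 (by norm_num)),
    bilateralKoebeSum_eq (hpow 6 (by norm_num)) (hpow 3 (by norm_num)),
    show q ^ 6 / q ^ 2 = q ^ 4 by field_simp, show q ^ 6 / q ^ 3 = q ^ 3 by field_simp,
    thetaQuotient_eq_ramanujanPsi hq hq0] at hsub
  have htri := koebeSum_trisect (hpow 2 two_ne_zero) (hpow 2 two_ne_zero)
  rw [← pow_mul, ← pow_add, ← pow_mul, ← pow_add] at htri
  have s2 := hasSum_koebeSum (hpow 2 two_ne_zero) (hpow 2 two_ne_zero)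
  have s6 := hasSum_koebeSum (hpow 6 (by norm_num)) (hpow 6 (by norm_num))
  have s3 := hasSum_koebeSum (hpow 6 (by norm_num)) (hpow 3 (by norm_num))
  -- The base `q⁶` sums at `q²` and `q⁴` are the full base `q²` sum minus the one at `q⁶`; the sum
  -- at `q³` is doubled because `q⁶ / q³ = q³`.
  have hval : q ^ 2 * ramanujanPsi (q ^ 3) ^ 6 / ramanujanPsi q ^ 2 =
      koebeSum (q ^ 2) (q ^ 2) - koebeSum (q ^ 6) (q ^ 6) - 2 * koebeSum (q ^ 6) (q ^ 3) := by
    rw [← hsub, htri]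
    ring
  rw [hval]
  have hs := (s2.sub s6).sub (s3.mul_left 2)
  refine (congrArg (HasSum · _) (funext fun n => ?_)).mpr hs
  rw [show 6 * (n + 1) - 3 = 6 * n + 3 by omega]
  simp only [← pow_mul, ← pow_add]
  ring_nf

theorem theorem1p2 (τ : ℂ) (hτ : 0 < τ.im) :
    gosperPi τ ≠ 0 ∧
    HasSum (fun n : ℕ =>
        nome τ ^ (2 * (n + 1)) / (1 - nome τ ^ (2 * (n + 1))) ^ 2
          - nome τ ^ (6 * (n + 1)) / (1 - nome τ ^ (6 * (n + 1))) ^ 2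
          - 2 * nome τ ^ (6 * (n + 1) - 3) / (1 - nome τ ^ (6 * (n + 1) - 3)) ^ 2)
      (gosperPi (3 * τ) ^ 3 / gosperPi τ) ∧
    gosperPi (3 * τ) ^ 3 / gosperPi τ =
      nome τ ^ 2 * ramanujanPsi (nome τ ^ 3) ^ 6 / ramanujanPsi (nome τ) ^ 2 := by
  refine ⟨gosperPi_ne_zero hτ, ?_, gosperPi_cube_div τ⟩
  rw [gosperPi_cube_div]
  simpa only [koebe, mul_div_assoc] using
    hasSum_koebe_eq_ramanujanPsi (norm_nome_lt_one hτ) (Complex.exp_ne_zero _)
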